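/- Let $m<n$, let $\mathbf A\in\mathbb R^{m\times n}$ have rank $m$, let $\mathbf b\in\mathbb R^m$, let $f_0:\mathbb R^n\to\mathbb R\cup\{+\infty\}$ be proper and lower semicontinuous (not necessarily convex), and let $\mathcal Y\subseteq\mathbb R^n$ be convex and compact. Put $f=f_0+\delta_{\mathcal Y}$, where $\delta_{\mathcal Y}$ is $0$ on $\mathcal Y$ and $+\infty$ elsewhere, let $f^*(\boldsymbol\nu)=\sup_{\mathbf y}(\boldsymbol\nu^{T}\mathbf y-f(\mathbf y))$ be its conjugate, and let $$g(\boldsymbol\lambda)=\inf_{\mathbf y\in\mathbb R^n}\bigl(f(\mathbf y)-\boldsymbol\lambda^{T}(\mathbf A\mathbf y-\mathbf b)\bigr)$$ be the (concave) dual function of the problem of minimizing $f(\mathbf y)$ subject to $\mathbf A\mathbf y=\mathbf b$. Let $\operatorname{con} f_0$ be the convex hull of the function $f_0$, and $$\mathcal V=\operatorname{cl}\{\boldsymbol\nu\in\partial(\operatorname{con} f_0)(\mathbf y)\;:\;\mathbf y\in\operatorname{int}\mathcal Y\}.$$ Here $\partial$ is the subdifferential of convex analysis for the convex functions $\operatorname{con}f_0$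 and $f^*$; for the concave function $g$, $\mathbf a\in\partial g(\boldsymbol\lambda)$ means that $g(\boldsymbol\lambda)$ is finite and $g(\boldsymbol\kappa)\le g(\boldsymbol\lambda)+\mathbf a^{T}(\boldsymbol\kappa-\boldsymbol\lambda)$ for all $\boldsymbol\kappa$; for the possibly nonconvex function $f$, $\partial f$ is the set of general (limiting) subgradients. Suppose that (i) for every $\bar{\mathbf y}\in\operatorname{bnd}\mathcal Y$ there are sequences $\mathbf y_k\in\mathcal Y$ and $\boldsymbol\nu_k\in\partial f(\mathbf y_k)$ with $\mathbf y_k\to\bar{\mathbf y}$ and $\limsup_{k}\|\boldsymbol\nu_k\|_2\ne\infty$; (ii) (an FSGOR ray lies in the range of $\mathbf A^{T}$) there are $\boldsymbol\nu\in\mathbb R^n$, a direction $\boldsymbol\eta\in\mathbb R^n\setminus\{\mathbf 0\}$ and $\bar{\mathbf y}\in\operatorname{bnd}\mathcal Y$ such that, for all $\alpha\ge0$, $\boldsymbol\nu+\alpha\boldsymbol\eta\in\mathbb R^n\setminus\mathcal V$ and $\bar{\mathbf y}\in\partial f^*(\boldsymbol\nu+\alpha\boldsymbol\eta)$, and the ray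 $\{\boldsymbol\nu+\alpha\boldsymbol\eta:\alpha\ge0\}$ is contained in the range of $\mathbf A^{T}$. Then there exist $\boldsymbol\lambda\in\mathbb R^m$, $\boldsymbol\mu\in\mathbb R^m$ with $\boldsymbol\mu\neq\mathbf 0$, and $\mathbf a\in\mathbb R^m$ such that $\mathbf a\in\partial g(\boldsymbol\lambda+\alpha\boldsymbol\mu)$ for all $\alpha\ge0$. That is, the dual function has a fixed subgradient along a ray. -/

import Mathlib

open Filter Topology

noncomputable section

namespace FSGOR

/-- `ℝⁿ` with its Euclidean inner product and norm. -/
abbrev Vec (n : ℕ) : Type := EuclideanSpace ℝ (Fin n)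

/-- An extended-real-valued function is proper: never `-∞`, and not identically `+∞`. -/
def IsProper {n : ℕ} (f : Vec n → EReal) : Prop :=
  (∀ x, f x ≠ ⊥) ∧ ∃ x, f x ≠ ⊤

/-- The indicator function `δ_C`: `0` on `C` and `+∞` off `C`. -/
def indicatorFn {n : ℕ} (C : Set (Vec n)) (x : Vec n) : EReal :=
  open Classical in if x ∈ C then 0 else ⊤

/-- The extended objective `f = f₀ + δ_Y`. -/
def extObjective {n : ℕ} (f₀ : Vec n → EReal) (Y : Set (Vec n)) (y : Vec n) : EReal :=
  f₀ y + indicatorFn Y y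

/-- The conjugate `f*(ν) = sup_x (νᵀx - f x)`; points with `f x = +∞` contribute `-∞`. -/
def conjugate {n : ℕ} (f : Vec n → EReal) (ν : Vec n) : EReal :=
  ⨆ x : Vec n, (((inner ℝ ν x : ℝ) : EReal) - f x)

/-- The epigraph of `f`, in `ℝⁿ × ℝ`. -/
def epigraph {n : ℕ} (f : Vec n → EReal) : Set (Vec n × ℝ) :=
  {p | f p.1 ≤ (p.2 : EReal)}

/-- The convex hull `con f` of a function `f` (its greatest convex minorant):
`con f (x) = inf {t ∈ ℝ | (x, t) ∈ con (epi f)}`. -/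
def convHullFn {n : ℕ} (f : Vec n → EReal) (x : Vec n) : EReal :=
  sInf ((fun t : ℝ => (t : EReal)) '' {t : ℝ | (x, t) ∈ convexHull ℝ (epigraph f)})

/-- The subdifferential of a convex function: `v ∈ ∂f(x)` iff `f x` is finite and
`f z ≥ f x + vᵀ(z - x)` for all `z`. -/
def subdifferential {n : ℕ} (f : Vec n → EReal) (x : Vec n) : Set (Vec n) :=
  {v | f x ≠ ⊥ ∧ f x ≠ ⊤ ∧ ∀ z, f x + ((inner ℝ v (z - x) : ℝ) : EReal) ≤ f z}

/-- The subdifferential of a concave function: `a ∈ ∂g(x)` iff `g x` is finite and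
`g z ≤ g x + aᵀ(z - x)` for all `z`; equivalently `-a ∈ ∂(-g)(x)`. -/
def concaveSubdifferential {m : ℕ} (g : Vec m → EReal) (x : Vec m) : Set (Vec m) :=
  {a | g x ≠ ⊥ ∧ g x ≠ ⊤ ∧ ∀ z, g z ≤ g x + ((inner ℝ a (z - x) : ℝ) : EReal)}

/-- Regular subgradients of an arbitrary function at a point where it is finite:
`f z ≥ f x + vᵀ(z - x) + o(‖z - x‖)` as `z → x`. -/
def regularSubdifferential {n : ℕ} (f : Vec n → EReal) (x : Vec n) : Set (Vec n) :=
  {v | f x ≠ ⊥ ∧ f x ≠ ⊤ ∧ ∀ ε : ℝ, 0 < ε →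
    ∀ᶠ z in 𝓝 x, f x + ((inner ℝ v (z - x) - ε * ‖z - x‖ : ℝ) : EReal) ≤ f z}

/-- (General, or limiting) subgradients of an arbitrary, possibly nonconvex, function at a point
where it is finite: limits of regular subgradients `v k` at points `x k → x` with
`f (x k) → f x`. For proper convex functions this is the subdifferential of convex analysis. -/
def generalSubdifferential {n : ℕ} (f : Vec n → EReal) (x : Vec n) : Set (Vec n) :=
  {v | f x ≠ ⊥ ∧ f x ≠ ⊤ ∧ ∃ (xs vs : ℕ → Vec n),
    Tendsto xs atTop (𝓝 x) ∧ Tendsto (fun k => f (xs k)) atTop (𝓝 (f x)) ∧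
    (∀ k, vs k ∈ regularSubdifferential f (xs k)) ∧ Tendsto vs atTop (𝓝 v)}

/-- Every boundary point of `Y` is the limit of a sequence of points of `Y` carrying subgradients
of `f = f₀ + δ_Y` whose norms do not have infinite limit superior. -/
def BoundarySubgradientsBounded {n : ℕ} (f₀ : Vec n → EReal) (Y : Set (Vec n)) : Prop :=
  ∀ ybar ∈ frontier Y, ∃ (y ν : ℕ → Vec n),
    (∀ k, y k ∈ Y) ∧ Tendsto y atTop (𝓝 ybar) ∧
    (∀ k, ν k ∈ generalSubdifferential (extObjective f₀ Y) (y k)) ∧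
    limsup (fun k => ‖ν k‖ₑ) atTop ≠ ⊤

/-- `V = cl {ν ∈ ∂(con f₀)(y) | y ∈ int Y}`. -/
def regionV {n : ℕ} (f₀ : Vec n → EReal) (Y : Set (Vec n)) : Set (Vec n) :=
  closure {ν | ∃ y ∈ interior Y, ν ∈ subdifferential (convHullFn f₀) y}

/-- The half-line from `ν` in direction `η`. -/
def halfLine {n : ℕ} (ν η : Vec n) : Set (Vec n) :=
  {x | ∃ α : ℝ, 0 ≤ α ∧ x = ν + α • η}

/-- The collection of rays outside `V` along which a fixed boundary point `ybar` of `Y` is a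
subgradient of the conjugate `f*` of `f = f₀ + δ_Y` (fixed subgradient over rays). -/
def fsgorRays {n : ℕ} (f₀ : Vec n → EReal) (Y : Set (Vec n)) : Set (Set (Vec n)) :=
  {R | ∃ ν η : Vec n, η ≠ 0 ∧ R = halfLine ν η ∧ ∃ ybar ∈ frontier Y,
    ∀ α : ℝ, 0 ≤ α → ν + α • η ∉ regionV f₀ Y ∧
      ybar ∈ subdifferential (conjugate (extObjective f₀ Y)) (ν + α • η)}

/-- The dual function `g(lam) = inf_y (f y - lamᵀ(A y - b))` of the problem of minimizing
`f = f₀ + δ_Y` subject to `A y = b`. -/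
def dualFn {m n : ℕ} (f₀ : Vec n → EReal) (Y : Set (Vec n)) (A : Matrix (Fin m) (Fin n) ℝ)
    (b : Vec m) (lam : Vec m) : EReal :=
  ⨅ y : Vec n, (extObjective f₀ Y y - ((inner ℝ lam (A.toEuclideanLin y - b) : ℝ) : EReal))

end FSGOR

end

/-!
The dual function is an affine function minus the conjugate composed with `Aᵀ`:
`g λ = λᵀ b - f*(Aᵀ λ)` (`FSGOR.dualFn_eq`), because `f y - λᵀ(A y - b) = λᵀ b - ((Aᵀ λ)ᵀ y - f y)`
for each `y`. The chain-rule inclusion for such a composition (`FSGOR.sub_mem_concaveSubdifferential`)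
says that every `y ∈ ∂f*(Aᵀ λ)` gives `b - A y ∈ ∂g(λ)`.

A ray `ν + α η` inside the range of `Aᵀ` is the image of a ray `λ + α μ`: take `Aᵀ λ = ν` and
`Aᵀ (λ + μ) = ν + η`. Since `Aᵀ μ = η ≠ 0`, the direction `μ` is nonzero. If a fixed `ȳ` belongs to
`∂f*` all along the first ray, then `b - A ȳ` belongs to `∂g` all along the second.
-/

namespace FSGOR

/-- Reflection about a real number reverses inequalities in `EReal`; finiteness of `d` excludes the
indeterminate differences. -/
theorem le_coe_sub_comm {d : ℝ} {x y : EReal} :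
    x ≤ (d : EReal) - y ↔ y ≤ (d : EReal) - x := by
  rw [EReal.le_sub_iff_add_le (Or.inr (EReal.coe_ne_bot d)) (Or.inr (EReal.coe_ne_top d)),
    EReal.le_sub_iff_add_le (Or.inr (EReal.coe_ne_bot d)) (Or.inr (EReal.coe_ne_top d)), add_comm]

theorem iInf_coe_sub {ι : Sort*} (d : ℝ) (u : ι → EReal) :
    ⨅ i, ((d : EReal) - u i) = (d : EReal) - ⨆ i, u i :=
  eq_of_forall_le_iff fun c => by
    rw [le_iInf_iff, le_coe_sub_comm, iSup_le_iff]
    exact forall_congr' fun _ => le_coe_sub_comm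

theorem inner_transpose_toEuclideanLin {m n : ℕ} (A : Matrix (Fin m) (Fin n) ℝ)
    (lam : Vec m) (y : Vec n) :
    inner ℝ (A.transpose.toEuclideanLin lam) y = inner ℝ lam (A.toEuclideanLin y) := by
  rw [← Matrix.conjTranspose_eq_transpose_of_trivial, Matrix.toEuclideanLin_conjTranspose_eq_adjoint,
    LinearMap.adjoint_inner_left]

theorem dualFn_eq {m n : ℕ} (f₀ : Vec n → EReal) (Y : Set (Vec n)) (A : Matrix (Fin m) (Fin n) ℝ)
    (b lam : Vec m) :
    dualFn f₀ Y A b lam =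
      ((inner ℝ lam b : ℝ) : EReal) -
        conjugate (extObjective f₀ Y) (A.transpose.toEuclideanLin lam) := by
  rw [conjugate, ← iInf_coe_sub, dualFn]
  refine iInf_congr fun y => ?_
  rw [inner_transpose_toEuclideanLin, inner_sub_right]
  induction extObjective f₀ Y y with
  | bot => simp
  | top => rw [EReal.top_sub_coe, EReal.sub_top, sub_eq_add_neg, EReal.neg_bot, EReal.coe_add_top]
  | coe r =>
    norm_cast
    ring

/-- The chain-rule inclusion `b - A ∂f*(Aᵀ λ) ⊆ ∂g(λ)`. -/
theorem sub_mem_concaveSubdifferential {m n : ℕ} {f₀ : Vec n → EReal} {Y : Set (Vec n)}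
    {A : Matrix (Fin m) (Fin n) ℝ} (b : Vec m) {lam : Vec m} {y : Vec n}
    (hy : y ∈ subdifferential (conjugate (extObjective f₀ Y)) (A.transpose.toEuclideanLin lam)) :
    b - A.toEuclideanLin y ∈ concaveSubdifferential (dualFn f₀ Y A b) lam := by
  obtain ⟨hbot, htop, hsub⟩ := hy
  obtain ⟨r, hr⟩ : ∃ r : ℝ, conjugate (extObjective f₀ Y) (A.transpose.toEuclideanLin lam) = r :=
    ⟨_, (EReal.coe_toReal htop hbot).symm⟩
  rw [hr] at hsub
  have hg : dualFn f₀ Y A b lam = ((inner ℝ lam b - r : ℝ) : EReal) := by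
    rw [dualFn_eq, hr, EReal.coe_sub]
  refine ⟨hg ▸ EReal.coe_ne_bot _, hg ▸ EReal.coe_ne_top _, fun kap => ?_⟩
  rw [hg, dualFn_eq]
  refine (EReal.sub_le_sub le_rfl (hsub (A.transpose.toEuclideanLin kap))).trans (le_of_eq ?_)
  rw [← map_sub, real_inner_comm (A.transpose.toEuclideanLin (kap - lam)),
    inner_transpose_toEuclideanLin, real_inner_comm (kap - lam)]
  simp only [inner_sub_left, inner_sub_right]
  norm_cast
  ring

end FSGOR

theorem mainTheorem7 {m n : ℕ} (hmn : m < n)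
    (A : Matrix (Fin m) (Fin n) ℝ) (hA : A.rank = m) (b : FSGOR.Vec m)
    (f₀ : FSGOR.Vec n → EReal) (hf₀ : FSGOR.IsProper f₀) (hlsc : LowerSemicontinuous f₀)
    (Y : Set (FSGOR.Vec n)) (hYconv : Convex ℝ Y) (hYcomp : IsCompact Y)
    (hbdd : FSGOR.BoundarySubgradientsBounded f₀ Y)
    (hray : ∃ R ∈ FSGOR.fsgorRays f₀ Y, R ⊆ Set.range A.transpose.toEuclideanLin) :
    ∃ lam mu : FSGOR.Vec m, mu ≠ 0 ∧ ∃ a : FSGOR.Vec m, ∀ α : ℝ, 0 ≤ α →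
      a ∈ FSGOR.concaveSubdifferential (FSGOR.dualFn f₀ Y A b) (lam + α • mu) := by
  obtain ⟨_, ⟨ν, η, hη, rfl, ybar, -, hfix⟩, hrange⟩ := hray
  obtain ⟨lam, hlam⟩ := hrange ⟨0, le_rfl, rfl⟩
  obtain ⟨kap, hkap⟩ := hrange ⟨1, zero_le_one, rfl⟩
  rw [zero_smul, add_zero] at hlam
  rw [one_smul] at hkap
  have hmu : A.transpose.toEuclideanLin (kap - lam) = η := by
    rw [map_sub, hkap, hlam, add_sub_cancel_left]
  refine ⟨lam, kap - lam, ?_, b - A.toEuclideanLin ybar, fun α hα => ?_⟩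
  · intro h
    rw [h, map_zero] at hmu
    exact hη hmu.symm
  · refine FSGOR.sub_mem_concaveSubdifferential b ?_
    rw [map_add, map_smul, hlam, hmu]
    exact (hfix α hα).2
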